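/- All monoids are abelian, written additively. Such a monoid $M$ is preordered by $x\le y$ iff $x+z=y$ for some $z\in M$. It is *regular* if $2x\le x$ for all $x$; *conical* if $x+y=0$ implies $x=y=0$; and a *refinement monoid* if $a_0+a_1=b_0+b_1$ in $M$ implies that there are $c_{i,j}\in M$ $(i,j<2)$ with $a_i=c_{i,0}+c_{i,1}$ and $b_i=c_{0,i}+c_{1,i}$ for all $i<2$. An *order-unit* of $M$ is an element $u$ such that for every $x\in M$ there is $n\in\mathbb{Z}_{\ge 0}$ with $x\le nu$. For an idempotent $e$ of $M$ (that is, $2e=e$), put $G_M[e]=\{x\in M: e\le x\le e\}$, which is a group under the addition of $M$ with neutral element $e$; for idempotents $a\le b$, let $j_{a,b}\colon G_M[a]\to G_M[b]$ be the group homomorphism $x\mapsto x+b$. We say that $M$ satisfies (emb) if $j_{a,b}$ is injective for all idempotents $a\le b$, and (pur) if the range of $j_{a,b}$ is a pure subgroup of $G_M[b]$ for all idempotents $a\le b$. (A subgroup $A$ of an abelian group $B$ is pure if for all $x\in B$ and all $n\ge 1$ with $nx\in A$ there is $y\in A$ with $nx=ny$.) For an abelian group $G$, denote by $G\sqcup\{0\}$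 the monoid obtained from $G$ by adjoining a new neutral element $0$. **Corollary 6.8.** Let $(M,u)$ be an abelian monoid with order-unit. Then $(M,u)$ is a direct limit, over a nonempty directed index set and with transition maps that are monoid homomorphisms preserving the distinguished elements, of finite (possibly empty) direct sums of pairs of the form $((\mathbb{Z}/n\mathbb{Z})\sqcup\{0\},\overline{m})$ with $n\ge 1$ and $m\in\mathbb{Z}$, and $(\mathbb{Z}\sqcup\{0\},m)$ with $m\in\mathbb{Z}$, if and only if $M$ is a regular conical refinement monoid satisfying (emb) and (pur). Here $\overline{m}$ and $m$ denote elements of the groups $\mathbb{Z}/n\mathbb{Z}$ and $\mathbb{Z}$, never the adjoined neutral element. -/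

import Mathlib

/-- The algebraic preordering of an abelian monoid: `x ≤ y` iff `x + z = y` for some `z`. -/
def AlgLE {M : Type*} [AddCommMonoid M] (x y : M) : Prop :=
  ∃ z : M, x + z = y

/-- `u` is an order-unit of `M`: every element of `M` lies below a multiple of `u`. -/
def IsOrderUnit {M : Type*} [AddCommMonoid M] (u : M) : Prop :=
  ∀ x : M, ∃ n : ℕ, AlgLE x (n • u)

/-- `M` is conical. -/
def IsConicalMonoid (M : Type*) [AddCommMonoid M] : Prop :=
  ∀ x y : M, x + y = 0 → x = 0 ∧ y = 0

/-- `M` is regular: `2x ≤ x` for all `x`. -/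
def IsRegularMonoid (M : Type*) [AddCommMonoid M] : Prop :=
  ∀ x : M, AlgLE (2 • x) x

/-- `M` is a refinement monoid. -/
def IsRefinementMonoid (M : Type*) [AddCommMonoid M] : Prop :=
  ∀ a₀ a₁ b₀ b₁ : M, a₀ + a₁ = b₀ + b₁ →
    ∃ c₀₀ c₀₁ c₁₀ c₁₁ : M,
      a₀ = c₀₀ + c₀₁ ∧ a₁ = c₁₀ + c₁₁ ∧ b₀ = c₀₀ + c₁₀ ∧ b₁ = c₀₁ + c₁₁

/-- `Λ(M)`, the set of idempotents of `M`. -/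
def idempotents (M : Type*) [AddCommMonoid M] : Set M :=
  {x | 2 • x = x}

/-- `G_M[e] = {x ∈ M | e ≤ x ≤ e}`; for an idempotent `e` this is a group under the addition
of `M`, with neutral element `e`. -/
def groupAt {M : Type*} [AddCommMonoid M] (e : M) : Set M :=
  {x | AlgLE e x ∧ AlgLE x e}

/-- Condition (emb): for idempotents `a ≤ b`, the natural map `G_M[a] → G_M[b]`, `x ↦ x + b`,
is injective. -/
def EmbeddingCondition (M : Type*) [AddCommMonoid M] : Prop :=
  ∀ a ∈ idempotents M, ∀ b ∈ idempotents M, AlgLE a b →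
    Set.InjOn (fun x : M => x + b) (groupAt a)

/-- Condition (pur): for idempotents `a ≤ b`, the range of the natural map `G_M[a] → G_M[b]`,
`x ↦ x + b`, is a pure subgroup of `G_M[b]`: if a positive multiple `n • x` of an element `x` of
`G_M[b]` lies in the range, then `n • x = n • y` for some `y` in the range. (Positive multiples
in the group `G_M[b]` are the same as in `M`; the case `n = 0` of purity is trivial.) -/
def PurityCondition (M : Type*) [AddCommMonoid M] : Prop :=
  ∀ a ∈ idempotents M, ∀ b ∈ idempotents M, AlgLE a b →
    ∀ n : ℕ, 0 < n → ∀ x ∈ groupAt b,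
      n • x ∈ (fun z : M => z + b) '' groupAt a →
        ∃ y ∈ (fun z : M => z + b) '' groupAt a, n • x = n • y

/-- The pair `(A, a)` is (isomorphic to) a finite, possibly empty, direct sum of pairs
`((ℤ/nℤ) ⊔ {0}, m̄)` with `n` positive, and `(ℤ ⊔ {0}, m)`, where `m` is an integer.
Here `ZMod 0` is `ℤ`, so `n k = 0` gives the second kind of summand. `WithZero G` is `G` with a
new neutral element adjoined, and `WithZero.coe` embeds `G` in it, so each component of the
distinguished element belongs to the group part (it is never the new zero, even if `m = 0`). -/
def IsFiniteSumOfPointedCyclic (A : Type*) [AddCommMonoid A] (a : A) : Prop :=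
  ∃ (r : ℕ) (n : Fin r → ℕ) (m : Fin r → ℤ) (e : A ≃+ (∀ k : Fin r, WithZero (ZMod (n k)))),
    e a = fun k => WithZero.coe (Int.cast (m k) : ZMod (n k))

/-- The pair `(M, u)` is a direct limit of finite direct sums of pairs `((ℤ/nℤ) ⊔ {0}, m̄)` and
`(ℤ ⊔ {0}, m)`. The direct system is indexed by a nonempty directed set, and its transition
maps are monoid homomorphisms that preserve the distinguished elements `v i`. -/
def IsDirectLimitOfPointedCyclicSums.{w} (M : Type w) [AddCommMonoid M] (u : M) : Prop :=
  ∃ (I : Type w) (_ : Preorder I) (_ : IsDirectedOrder I) (_ : Nonempty I)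
    (G : I → Type w) (_ : ∀ i, AddCommMonoid (G i)) (v : ∀ i, G i)
    (f : ∀ i j, i ≤ j → G i →+ G j) (_ : DirectedSystem G (f · · ·)),
    (∀ i, IsFiniteSumOfPointedCyclic (G i) (v i)) ∧
    (∀ i j (h : i ≤ j), f i j h (v i) = v j) ∧
    ∃ e : DirectLimit G f ≃+ M, ∀ i, e ⟦⟨i, v i⟩⟧ = u

/-! In a regular monoid `M` every element lies in the group of a unique idempotent. Under (emb) an
element is determined by this idempotent and its class in the Grothendieck group `G`
(`ext_idem_of`). So `M` is controlled by its order ideals and by the map sending an ideal to the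
subgroup of `G` it generates. Refinement makes the ideals a distributive lattice and this map a
lattice homomorphism (`subgroup_sup`, `subgroup_inf`). By (pur) its values are pure
(`subgroup_pure`).

Let `S` be a finitely generated submonoid containing `u`. It meets only a finite distributive
lattice `L` of ideals and a finitely generated subgroup of `G`. Purity splits the inclusion of that
subgroup into a sum of maps `θ p`, one for each join-irreducible `p` of `L`, where `θ p` takes
values in the subgroup of `p` and kills the classes from ideals in `L` not above `p`. The image of
`θ p` is a retract of a product of cyclic groups. Adjoining zeros, with a nonzero component at `x`
exactly when `p` lies below the ideal of `x`, factors the inclusion of `S` through a finite sum of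
monoids `(ℤ/nℤ) ⊔ {0}` (`exists_factorization`). The order-unit lies above every `p`, so its
components are nonzero.

Such factorizations for all `S` assemble into a direct system with limit `M`: map one stage into
`M`, then into the stage of a larger submonoid. Conversely, the axioms can be stated with
existential witnesses and no order. In that form they hold for a group with zero adjoined, and they
pass to finite products and direct limits. -/

/-! ### Splitting homomorphisms along pure subgroups and finite distributive lattices -/

/-- Every finitely generated abelian group is a retract of a finite product of cyclic groups, where
the index set of the product may be taken nonempty. -/
theorem AddGroup.FG.exists_retract_zmod (N : Type*) [AddCommGroup N] [AddGroup.FG N] :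
    ∃ (J : Type) (_ : Fintype J) (_ : DecidableEq J) (_ : Nonempty J) (n : J → ℕ)
      (α : N →+ ∀ j, ZMod (n j)) (β : (∀ j, ZMod (n j)) →+ N), ∀ x, β (α x) = x := by
  classical
  obtain ⟨n, ι, _, p, _, e, ⟨φ⟩⟩ := AddCommGroup.equiv_free_prod_directSum_zmod N
  let ι' := Fin (Fintype.card ι)
  let q : ι' ≃ ι := (Fintype.equivFin ι).symm
  -- The extra index `none` carries the trivial group `ZMod 1`. It keeps the index set nonempty even
  -- when `N = 0`.
  let m : Option (Fin n ⊕ ι') → ℕ := fun o => o.elim 1 (Sum.elim (fun _ => 0)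
    (fun i => p (q i) ^ e (q i)))
  let α₀ : ((Fin n →₀ ℤ) × DirectSum ι fun i => ZMod (p i ^ e i)) →+ ∀ j, ZMod (m j) :=
    { toFun := fun x j => match j with
        | none => (0 : ZMod 1)
        | some (.inl k) => (x.1 k : ℤ)
        | some (.inr k) => x.2 (q k)
      map_zero' := by
        funext j
        rcases j with _ | k | k <;> rfl
      map_add' := by
        intro x y
        funext j
        rcases j with _ | k | k
        · rfl
        · rfl
        · exact DirectSum.add_apply _ _ _ }
  let β₀ : (∀ j, ZMod (m j)) →+ ((Fin n →₀ ℤ) × DirectSum ι fun i => ZMod (p i ^ e i)) :=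
    { toFun := fun y => (Finsupp.equivFunOnFinite.symm fun k => (y (some (.inl k)) : ZMod 0),
        ∑ k : ι', DirectSum.of (fun i => ZMod (p i ^ e i)) (q k) (y (some (.inr k))))
      map_zero' := by
        refine Prod.ext ?_ ?_
        · ext k; rfl
        · change ∑ k : ι', DirectSum.of (fun i => ZMod (p i ^ e i)) (q k) 0 = 0
          simp only [map_zero, Finset.sum_const_zero]
      map_add' := by
        intro x y
        refine Prod.ext ?_ ?_
        · ext k; rfl
        · have h : ∀ u v : ∀ k : ι', ZMod (p (q k) ^ e (q k)),
              ∑ k, DirectSum.of (fun i => ZMod (p i ^ e i)) (q k) (u k + v k) =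
                ∑ k, DirectSum.of (fun i => ZMod (p i ^ e i)) (q k) (u k) +
                  ∑ k, DirectSum.of (fun i => ZMod (p i ^ e i)) (q k) (v k) := fun u v => by
            simp only [map_add, Finset.sum_add_distrib]
          exact h (fun k => x (some (.inr k))) (fun k => y (some (.inr k))) }
  have h₀ : ∀ x, β₀ (α₀ x) = x := by
    intro x
    refine Prod.ext ?_ ?_
    · ext k; rfl
    · change ∑ k : ι', DirectSum.of (fun i => ZMod (p i ^ e i)) (q k) (x.2 (q k)) = x.2
      rw [q.sum_comp (fun i => DirectSum.of (fun i => ZMod (p i ^ e i)) i (x.2 i))]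
      exact DirectSum.sum_univ_of x.2
  refine ⟨_, inferInstance, inferInstance, inferInstance, m, α₀.comp φ.toAddMonoidHom,
    φ.symm.toAddMonoidHom.comp β₀, fun x => ?_⟩
  change φ.symm (β₀ (α₀ (φ x))) = x
  rw [h₀, φ.symm_apply_apply]

/-- Homomorphisms from a finitely generated group `Γ` into `P ⊔ A` can be corrected modulo `A` to
homomorphisms into `P` vanishing on the preimage of `A`, provided that `P ⊓ A` is pure. -/
theorem AddMonoidHom.exists_sub_mem_of_pure {G Γ : Type*} [AddCommGroup G] [AddCommGroup Γ]
    [AddGroup.FG Γ] (f : Γ →+ G) (P A : AddSubgroup G) (hf : ∀ x, f x ∈ P ⊔ A)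
    (hpure : ∀ n : ℕ, 0 < n → ∀ x, n • x ∈ P ⊓ A → ∃ y ∈ P ⊓ A, n • x = n • y) :
    ∃ τ : Γ →+ G, (∀ x, τ x ∈ P) ∧ (∀ x, f x - τ x ∈ A) ∧ ∀ x, f x ∈ A → τ x = 0 := by
  let Z : AddSubgroup Γ := A.comap f
  obtain ⟨J, _, _, -, n, α, β, hβα⟩ := AddGroup.FG.exists_retract_zmod (Γ ⧸ Z)
  -- Each cyclic generator of the cover of `Γ ⧸ Z` needs a value `t` in `P` that agrees with `f`
  -- modulo `A` and respects the order `n j`.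
  have hex : ∀ j, ∃ (g : Γ) (t : G), (g : Γ ⧸ Z) = β (Pi.single j 1) ∧ t ∈ P ∧ f g - t ∈ A ∧
      n j • t = 0 := by
    intro j
    obtain ⟨g, hg⟩ := QuotientAddGroup.mk_surjective (β (Pi.single j 1))
    obtain ⟨p, hp, a, ha, hpa⟩ := AddSubgroup.mem_sup.1 (hf g)
    have hng : f (n j • g) ∈ A := by
      have : (n j • g : Γ) ∈ Z := by
        rw [← QuotientAddGroup.eq_zero_iff]
        change n j • (g : Γ ⧸ Z) = 0
        have h1 : n j • (Pi.single j 1 : ∀ j, ZMod (n j)) = 0 := by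
          rw [← Pi.single_smul, nsmul_one, ZMod.natCast_self, Pi.single_zero]
        rw [hg, ← map_nsmul, h1, map_zero]
      exact this
    have hnp : n j • p ∈ P ⊓ A := by
      refine ⟨P.nsmul_mem hp _, ?_⟩
      have : n j • p = f (n j • g) - n j • a := by rw [map_nsmul, ← hpa, nsmul_add]; abel
      rw [this]
      exact A.sub_mem hng (A.nsmul_mem ha _)
    rcases Nat.eq_zero_or_pos (n j) with h0 | hpos
    · exact ⟨g, p, hg, hp, by rw [← hpa]; simpa using ha, by rw [h0, zero_nsmul]⟩
    · obtain ⟨y, hy, hny⟩ := hpure (n j) hpos p hnp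
      -- Purity supplies `y` in `P ⊓ A` with the same multiple as `p`. Subtracting it makes the
      -- value torsion of order dividing `n j` without changing its class modulo `A`.
      refine ⟨g, p - y, hg, P.sub_mem hp hy.1, ?_, by rw [nsmul_sub, hny, sub_self]⟩
      rw [← hpa, show p + a - (p - y) = a + y by abel]
      exact A.add_mem ha hy.2
  choose g t hg htP htA hnt using hex
  let θ : ∀ j, ZMod (n j) →+ G := fun j => ZMod.lift (n j) ⟨zmultiplesHom G (t j), by
    simpa using hnt j⟩
  have hθ1 : ∀ j, θ j 1 = t j := by
    intro j
    have := ZMod.lift_coe (n j) (⟨zmultiplesHom G (t j), by simpa using hnt j⟩ :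
      { f : ℤ →+ G // f (n j) = 0 }) 1
    simpa [θ] using this
  let σ : (∀ j, ZMod (n j)) →+ G := ∑ j, (θ j).comp (Pi.evalAddMonoidHom _ j)
  have hσ : ∀ y, σ y = ∑ j, θ j (y j) := fun y => by simp [σ]
  have hθP : ∀ j y, θ j y ∈ P := by
    intro j y
    obtain ⟨k, rfl⟩ := ZMod.intCast_surjective y
    rw [← zsmul_one, map_zsmul, hθ1]
    exact P.zsmul_mem (htP j) k
  -- Modulo `A`, `σ` is the map induced by `f` composed with `β`. Precomposing with the section `α`
  -- recovers `f`.
  have hcomp : (QuotientAddGroup.mk' A).comp σ = (QuotientAddGroup.map Z A f le_rfl).comp β := by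
    refine AddMonoidHom.functions_ext' _ _ _ fun j => ?_
    ext x
    obtain ⟨k, rfl⟩ := ZMod.intCast_surjective x
    have h1 : σ (Pi.single j 1) = t j := by
      rw [hσ, Finset.sum_eq_single j, Pi.single_eq_same, hθ1]
      · intro b _ hb
        rw [Pi.single_eq_of_ne hb, map_zero]
      · simp
    have h2 : (QuotientAddGroup.mk' A) (σ (Pi.single j 1)) =
        (QuotientAddGroup.map Z A f le_rfl) (β (Pi.single j 1)) := by
      rw [h1, ← hg]
      refine (QuotientAddGroup.eq.2 ?_)
      rw [neg_add_eq_sub]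
      exact htA j
    have h3 : (Pi.single j ((k : ℤ) : ZMod (n j)) : ∀ j, ZMod (n j)) = k • Pi.single j 1 := by
      rw [← Pi.single_smul, zsmul_one]
    simp only [AddMonoidHom.comp_apply, AddMonoidHom.single_apply]
    rw [h3, map_zsmul, map_zsmul, map_zsmul, map_zsmul, h2]
  refine ⟨σ.comp (α.comp (QuotientAddGroup.mk' Z)), fun x => ?_, fun x => ?_, fun x hx => ?_⟩
  · rw [AddMonoidHom.comp_apply, hσ]
    exact P.sum_mem fun j _ => hθP j _
  · have := DFunLike.congr_fun hcomp (α (x : Γ ⧸ Z))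
    rw [AddMonoidHom.comp_apply, AddMonoidHom.comp_apply, hβα] at this
    have := QuotientAddGroup.eq.1 this
    rwa [neg_add_eq_sub] at this
  · have : (x : Γ ⧸ Z) = 0 := (QuotientAddGroup.eq_zero_iff x).2 hx
    simp [this]

/-- In a finite distributive lattice, every `a ≠ ⊥` is the join of a join-irreducible element `p`
and an element `b` not above `p` that bounds all the elements of `[⊥, a]` not above `p`. -/
theorem exists_supIrred_sup_eq {L : Type*} [DistribLattice L] [OrderBot L] [Finite L] {a : L}
    (ha : a ≠ ⊥) :
    ∃ p b : L, SupIrred p ∧ p ⊔ b = a ∧ ¬ p ≤ b ∧ ∀ c ≤ a, ¬ p ≤ c → c ≤ b := by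
  classical
  have := Fintype.ofFinite L
  let Q : Finset L := Finset.univ.filter fun q => SupIrred q ∧ q ≤ a
  have hle : ∀ c ≤ a, ∀ d, (∀ q ∈ Q, q ≤ c → q ≤ d) → c ≤ d := by
    intro c hc d hd
    obtain ⟨s, hs, hirr⟩ := exists_supIrred_decomposition c
    rw [← hs]
    refine Finset.sup_le fun q hq => ?_
    have hqc : q ≤ c := hs ▸ Finset.le_sup (f := id) hq
    exact hd q (by simp [Q, hirr hq, hqc.trans hc]) hqc
  have hQ : Q.Nonempty := by
    by_contra h
    rw [Finset.not_nonempty_iff_eq_empty] at h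
    exact ha (le_bot_iff.1 (hle a le_rfl ⊥ (by simp [h])))
  obtain ⟨p, hp⟩ := Q.exists_maximal hQ
  have hpQ : SupIrred p ∧ p ≤ a := by simpa [Q] using hp.1
  -- Here `p` is a maximal irreducible below `a` and `b` is the join of the others. As `p` is prime,
  -- `p ≤ b` would put `p` below another irreducible, against maximality.
  refine ⟨p, (Q.erase p).sup id, hpQ.1, ?_, ?_, ?_⟩
  · refine le_antisymm (sup_le hpQ.2 (Finset.sup_le fun q hq => ?_)) (hle a le_rfl _ ?_)
    · have := Finset.mem_of_mem_erase hq
      simp only [Q, Finset.mem_filter] at this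
      exact this.2.2
    · intro q hq _
      by_cases h : q = p
      · exact h ▸ le_sup_left
      · exact le_sup_of_le_right (Finset.le_sup (f := id) (Finset.mem_erase.2 ⟨h, hq⟩))
  · intro h
    obtain ⟨q, hq, hpq⟩ := (supPrime_iff_supIrred.2 hpQ.1).le_finset_sup.1 h
    rw [Finset.mem_erase] at hq
    exact hq.1 (le_antisymm (hp.2 hq.2 hpq) hpq)
  · intro c hc hpc
    refine hle c hc _ fun q hq hqc => Finset.le_sup (f := id) (Finset.mem_erase.2 ⟨?_, hq⟩)
    rintro rfl
    exact hpc hqc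

/-- A homomorphism from a finitely generated group into a group graded by pure subgroups over a
finite distributive lattice splits along the join-irreducible elements of the lattice. -/
theorem AddMonoidHom.exists_supIrred_decomposition {L G Γ : Type*} [DistribLattice L] [OrderBot L]
    [Fintype L] [AddCommGroup G] [AddCommGroup Γ] [AddGroup.FG Γ] (H : L → AddSubgroup G)
    (hbot : H ⊥ = ⊥) (hsup : ∀ a b, H (a ⊔ b) = H a ⊔ H b) (hinf : ∀ a b, H (a ⊓ b) = H a ⊓ H b)
    (hpure : ∀ a, ∀ n : ℕ, 0 < n → ∀ x, n • x ∈ H a → ∃ y ∈ H a, n • x = n • y) (a : L) :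
    ∀ f : Γ →+ G, (∀ x, f x ∈ H a) →
      ∃ θ : L → Γ →+ G, (∀ p x, θ p x ∈ H p) ∧ (∀ p, ¬ SupIrred p → θ p = 0) ∧
        (∀ x, ∑ p, θ p x = f x) ∧ ∀ c p x, f x ∈ H c → ¬ p ≤ c → θ p x = 0 := by
  classical
  induction a using WellFoundedLT.induction with
  | ind a ih =>
  intro f hf
  by_cases ha : a = ⊥
  · subst ha
    have h0 : ∀ x, f x = 0 := fun x => by simpa [hbot] using hf x
    exact ⟨0, fun p x => zero_mem _, fun _ _ => rfl, fun x => by simp [h0], fun _ _ _ _ _ => rfl⟩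
  obtain ⟨p, b, hp, rfl, hpb, hb⟩ := exists_supIrred_sup_eq ha
  have hmono : ∀ {c d}, c ≤ d → H c ≤ H d := by
    intro c d h
    rw [← sup_eq_right.2 h, hsup]
    exact le_sup_left
  -- Peel off the `p`-part: `τ` maps into `H p`, and `f - τ` maps into `H b` with `b` strictly below
  -- `p ⊔ b`, so induction applies.
  obtain ⟨τ, hτP, hτA, hτ0⟩ := f.exists_sub_mem_of_pure (H p) (H b)
    (fun x => hsup p b ▸ hf x) (by rw [← hinf]; exact hpure _)
  obtain ⟨θ, hθ, hθirr, hθsum, hθ0⟩ := ih b (lt_of_le_of_ne le_sup_right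
    (fun h => hpb (h ▸ le_sup_left))) (f - τ) hτA
  refine ⟨fun q => if q = p then θ q + τ else θ q, fun q x => ?_, fun q hq => ?_, fun x => ?_,
    fun c q x hx hqc => ?_⟩
  · by_cases h : q = p
    · subst h
      simpa using (H q).add_mem (hθ q x) (hτP x)
    · simpa [h] using hθ q x
  · have h : q ≠ p := fun h => hq (h ▸ hp)
    simpa [h] using hθirr q hq
  · have h1 : ∀ q, (if q = p then θ q + τ else θ q) x = θ q x + if q = p then τ x else 0 := by
      intro q
      split_ifs <;> simp
    simp only [h1, Finset.sum_add_distrib, hθsum]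
    simp
  · have hx' : f x ∈ H (c ⊓ (p ⊔ b)) := hinf c _ ▸ ⟨hx, hf x⟩
    have hτx : ¬ p ≤ c → τ x = 0 := fun hpc =>
      hτ0 x (hmono (hb _ inf_le_right fun h => hpc (h.trans inf_le_left)) hx')
    -- Subtracting `τ x` does not leave `H c`: either `p ≤ c` and `τ x` lies in `H p ≤ H c`, or `τ x
    -- = 0`.
    have hfx : (f - τ) x ∈ H (c ⊓ b) := by
      rw [hinf]
      refine ⟨?_, hτA x⟩
      by_cases hpc : p ≤ c
      · exact (H c).sub_mem hx (hmono hpc (hτP x))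
      · rw [AddMonoidHom.sub_apply, hτx hpc, sub_zero]
        exact hx
    have hθx : θ q x = 0 := hθ0 _ q x hfx fun h => hqc (h.trans inf_le_left)
    by_cases h : q = p
    · subst h
      simp [hθx, hτx hqc]
    · simp [h, hθx]

/-! ### Idempotents and order ideals of regular refinement monoids -/

/-- Regular conical refinement monoids satisfying the embedding and purity conditions. -/
class IsPureRefinementMonoid (M : Type*) [AddCommMonoid M] : Prop where
  regular : IsRegularMonoid M
  conical : IsConicalMonoid M
  refinement : IsRefinementMonoid M
  emb : EmbeddingCondition M
  pur : PurityCondition M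

theorem AlgLE.trans {M : Type*} [AddCommMonoid M] {x y z : M} (h : AlgLE x y) (h' : AlgLE y z) :
    AlgLE x z := by
  obtain ⟨a, rfl⟩ := h
  obtain ⟨b, rfl⟩ := h'
  exact ⟨a + b, (add_assoc _ _ _).symm⟩

open Algebra.GrothendieckAddGroup in
theorem Algebra.GrothendieckAddGroup.of_eq_iff {M : Type*} [AddCommMonoid M] {x y : M} :
    of x = of y ↔ ∃ c, x + c = y + c := by
  rw [show of x = AddLocalization.addMonoidOf ⊤ x from rfl,
    show of y = AddLocalization.addMonoidOf ⊤ y from rfl,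
    AddSubmonoid.LocalizationMap.eq_iff_exists]
  constructor
  · rintro ⟨c, hc⟩
    exact ⟨c, by rw [add_comm, hc, add_comm]⟩
  · rintro ⟨c, hc⟩
    exact ⟨⟨c, AddSubmonoid.mem_top c⟩, by simpa [add_comm] using hc⟩

/-- The hereditary submonoids (order ideals) of `M`. -/
def OrderIdeal (M : Type*) [AddCommMonoid M] : Type _ :=
  { I : AddSubmonoid M // ∀ x y, AlgLE x y → y ∈ I → x ∈ I }

namespace OrderIdeal

variable {M : Type*} [AddCommMonoid M]

instance : Membership M (OrderIdeal M) := ⟨fun I x => x ∈ I.1⟩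

theorem zero_mem (I : OrderIdeal M) : 0 ∈ I := I.1.zero_mem

theorem add_mem (I : OrderIdeal M) {x y : M} (hx : x ∈ I) (hy : y ∈ I) : x + y ∈ I :=
  I.1.add_mem hx hy

theorem mem_of_algLE (I : OrderIdeal M) {x y : M} (h : AlgLE x y) (hy : y ∈ I) : x ∈ I :=
  I.2 x y h hy

end OrderIdeal

namespace IsPureRefinementMonoid

variable {M : Type*} [AddCommMonoid M] [IsPureRefinementMonoid M]

/-- A complement of `x`: adding it to `x` yields the idempotent of the group of `x`. -/
noncomputable def opp (x : M) : M := (regular (M := M) x).choose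

/-- The unique idempotent `e` with `e ≤ x ≤ e`. -/
noncomputable def idem (x : M) : M := x + opp x

theorem add_idem (x : M) : x + idem x = x := by
  have h : 2 • x + opp x = x := (regular (M := M) x).choose_spec
  rw [two_nsmul] at h
  rw [idem, ← add_assoc, h]

/-- Two elements that fix `x` and lie above `x` absorb each other, hence are equal. -/
theorem idem_eq {x e w : M} (h : x + e = x) (hw : x + w = e) : idem x = e := by
  have h1 : e + idem x = e := by
    rw [← hw, add_right_comm, add_idem]
  have h2 : idem x + e = idem x := by
    rw [idem, add_right_comm, h]
  rw [← h1, add_comm, h2]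

theorem idem_add_idem (x : M) : idem x + idem x = idem x := by
  conv_lhs => enter [1]; rw [idem]
  rw [add_right_comm, add_idem, ← idem]

theorem idem_of_add_self {e : M} (h : e + e = e) : idem e = e := idem_eq h h

theorem idem_add (x y : M) : idem (x + y) = idem x + idem y := by
  refine idem_eq (w := opp x + opp y) ?_ ?_
  · rw [add_add_add_comm, add_idem, add_idem]
  · rw [add_add_add_comm, idem, idem]

theorem idem_idem (x : M) : idem (idem x) = idem x := idem_of_add_self (idem_add_idem x)

theorem idem_zero : idem (0 : M) = 0 := idem_of_add_self (add_zero 0)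

/-- `idem` as a homomorphism. -/
noncomputable def idemHom : M →+ M where
  toFun := idem
  map_zero' := idem_zero
  map_add' := idem_add

/-- This makes the order equational, with `x` entering only through its idempotent. Conversely, `opp
x + y` is the required complement. -/
theorem algLE_iff {x y : M} : AlgLE x y ↔ y + idem x = y := by
  constructor
  · rintro ⟨z, rfl⟩
    rw [add_right_comm, add_idem]
  · intro h
    refine ⟨opp x + y, ?_⟩
    rw [← add_assoc, ← idem, add_comm, h]

theorem idem_algLE (x : M) : AlgLE (idem x) x := algLE_iff.2 (by rw [idem_idem, add_idem])

theorem algLE_idem (x : M) : AlgLE x (idem x) := ⟨opp x, rfl⟩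

theorem opp_algLE (x : M) : AlgLE (opp x) (idem x) := ⟨x, add_comm _ _⟩

theorem idem_mem_idempotents (x : M) : idem x ∈ idempotents M := by
  change 2 • idem x = idem x
  rw [two_nsmul, idem_add_idem]

theorem mem_groupAt_idem (x : M) : x ∈ groupAt (idem x) := ⟨idem_algLE x, algLE_idem x⟩

/-- Cancellation inside the groups of a monoid with the embedding condition. -/
theorem eq_of_add_eq {x y c : M} (hxy : idem x = idem y) (h : x + c = y + c) : x = y := by
  refine emb (idem x) (idem_mem_idempotents x) (idem (x + c)) (idem_mem_idempotents _)
    ⟨idem c, (idem_add x c).symm⟩ (mem_groupAt_idem x) (hxy ▸ mem_groupAt_idem y) ?_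
  change x + idem (x + c) = y + idem (x + c)
  have hy : y + idem x = y := hxy ▸ add_idem y
  rw [idem_add, ← add_assoc, add_idem, ← add_assoc, hy, idem, ← add_assoc, h, add_assoc]

/-- Riesz decomposition, read off from a refinement of `x + z = j + k`. It makes a sum of order
ideals hereditary. -/
theorem exists_add_of_algLE_add {x j k : M} (h : AlgLE x (j + k)) :
    ∃ j' k', x = j' + k' ∧ AlgLE j' j ∧ AlgLE k' k := by
  obtain ⟨z, hz⟩ := h
  obtain ⟨a, b, c, d, rfl, rfl, rfl, rfl⟩ := refinement (M := M) _ _ _ _ hz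
  exact ⟨a, b, rfl, ⟨c, rfl⟩, ⟨d, rfl⟩⟩

end IsPureRefinementMonoid

open IsPureRefinementMonoid

namespace OrderIdeal

variable {M : Type*} [AddCommMonoid M] [IsPureRefinementMonoid M]

noncomputable instance : Lattice (OrderIdeal M) :=
  Subtype.lattice
    (fun {I J} hI hJ x y hxy hy => by
      obtain ⟨j, hj, k, hk, rfl⟩ := AddSubmonoid.mem_sup.1 hy
      obtain ⟨j', k', rfl, hj', hk'⟩ := exists_add_of_algLE_add hxy
      exact AddSubmonoid.mem_sup.2 ⟨j', hI _ _ hj' hj, k', hJ _ _ hk' hk, rfl⟩)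
    (fun {I J} hI hJ x y hxy hy => AddSubmonoid.mem_inf.2
      ⟨hI _ _ hxy (AddSubmonoid.mem_inf.1 hy).1, hJ _ _ hxy (AddSubmonoid.mem_inf.1 hy).2⟩)

theorem mem_sup {I J : OrderIdeal M} {x : M} : x ∈ I ⊔ J ↔ ∃ y ∈ I, ∃ z ∈ J, y + z = x :=
  AddSubmonoid.mem_sup

theorem mem_inf {I J : OrderIdeal M} {x : M} : x ∈ I ⊓ J ↔ x ∈ I ∧ x ∈ J := Iff.rfl

theorem idem_mem (I : OrderIdeal M) {x : M} (hx : x ∈ I) : idem x ∈ I :=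
  I.mem_of_algLE (idem_algLE x) hx

theorem opp_mem (I : OrderIdeal M) {x : M} (hx : x ∈ I) : opp x ∈ I :=
  I.mem_of_algLE (opp_algLE x) (I.idem_mem hx)

noncomputable instance : DistribLattice (OrderIdeal M) :=
  DistribLattice.ofInfSupLe fun I J K x hx => by
    obtain ⟨hxI, hx⟩ := mem_inf.1 hx
    obtain ⟨j, hj, k, hk, rfl⟩ := mem_sup.1 hx
    exact mem_sup.2 ⟨j, ⟨I.mem_of_algLE ⟨k, rfl⟩ hxI, hj⟩, k,
      ⟨I.mem_of_algLE ⟨j, add_comm _ _⟩ hxI, hk⟩, rfl⟩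

instance : OrderBot (OrderIdeal M) where
  -- Conicality says exactly that `{0}` is hereditary.
  bot := ⟨⊥, by
    rintro x y ⟨z, rfl⟩ h
    exact (conical (M := M) _ _ h).1⟩
  bot_le I x hx := by
    have : x = 0 := hx
    exact this ▸ I.zero_mem

/-- The order ideal of all elements below a multiple of `x`. -/
noncomputable def principal (x : M) : OrderIdeal M :=
  ⟨{ carrier := {y | AlgLE y (idem x)}
     zero_mem' := ⟨idem x, zero_add _⟩
     add_mem' := by
      rintro a b ha hb
      have ha := algLE_iff.1 ha
      have hb := algLE_iff.1 hb
      refine algLE_iff.2 ?_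
      rw [idem_add, ← add_assoc, ha, hb] },
    fun _ _ h h' => h.trans h'⟩

theorem mem_principal {x y : M} : y ∈ principal x ↔ AlgLE y (idem x) := Iff.rfl

theorem mem_principal_self (x : M) : x ∈ principal x := algLE_idem x

theorem principal_le {x : M} {I : OrderIdeal M} : principal x ≤ I ↔ x ∈ I :=
  ⟨fun h => h (mem_principal_self x), fun h _ hy => I.mem_of_algLE hy (I.idem_mem h)⟩

theorem principal_zero : principal (0 : M) = ⊥ :=
  le_antisymm (principal_le.2 (zero_mem _)) bot_le

theorem principal_add (x y : M) : principal (x + y) = principal x ⊔ principal y := by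
  refine le_antisymm (principal_le.2 (mem_sup.2
    ⟨x, mem_principal_self x, y, mem_principal_self y, rfl⟩)) (sup_le ?_ ?_) <;>
    refine principal_le.2 (mem_of_algLE _ ?_ (mem_principal_self (x + y)))
  · exact ⟨y, rfl⟩
  · exact ⟨x, add_comm _ _⟩

end OrderIdeal

/-! ### The Grothendieck group and its subgroups attached to order ideals -/

open Algebra.GrothendieckAddGroup

namespace IsPureRefinementMonoid

variable {M : Type*} [AddCommMonoid M] [IsPureRefinementMonoid M]

theorem of_idem (x : M) : of (idem x) = 0 := by
  have h := congrArg of (idem_add_idem x)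
  rwa [map_add, add_eq_left] at h

theorem of_opp (x : M) : of (opp x) = - of x := by
  have h := of_idem x
  rw [idem, map_add] at h
  exact eq_neg_of_add_eq_zero_right h

/-- Complements already represent inverses, so no formal differences are needed. -/
theorem of_surjective : Function.Surjective (of : M → Algebra.GrothendieckAddGroup M) := by
  intro g
  obtain ⟨⟨a, b⟩, h⟩ := AddSubmonoid.LocalizationMap.surj (AddLocalization.addMonoidOf
    (⊤ : AddSubmonoid M)) g
  refine ⟨a + opp (b : M), ?_⟩
  rw [map_add, of_opp]
  exact (eq_add_neg_of_add_eq h).symm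

/-- An element is determined by its idempotent and its image in the Grothendieck group. -/
theorem ext_idem_of {x y : M} (h : idem x = idem y) (h' : of x = of y) : x = y := by
  obtain ⟨c, hc⟩ := of_eq_iff.1 h'
  exact eq_of_add_eq h hc

end IsPureRefinementMonoid

namespace OrderIdeal

variable {M : Type*} [AddCommMonoid M] [IsPureRefinementMonoid M]

/-- The subgroup of the Grothendieck group of `M` generated by an order ideal. -/
noncomputable def subgroup (I : OrderIdeal M) : AddSubgroup (Algebra.GrothendieckAddGroup M) where
  carrier := of '' {x | x ∈ I}
  zero_mem' := ⟨0, I.zero_mem, map_zero _⟩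
  add_mem' := by
    rintro _ _ ⟨x, hx, rfl⟩ ⟨y, hy, rfl⟩
    exact ⟨x + y, I.add_mem hx hy, map_add _ _ _⟩
  neg_mem' := by
    rintro _ ⟨x, hx, rfl⟩
    exact ⟨opp x, I.opp_mem hx, of_opp x⟩

theorem subgroup_bot : (⊥ : OrderIdeal M).subgroup = ⊥ := by
  refine le_bot_iff.1 ?_
  rintro _ ⟨x, hx, rfl⟩
  rw [show x = 0 from hx, map_zero]
  exact AddSubgroup.zero_mem _

theorem subgroup_sup (I J : OrderIdeal M) : (I ⊔ J).subgroup = I.subgroup ⊔ J.subgroup := by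
  ext g
  rw [AddSubgroup.mem_sup]
  constructor
  · rintro ⟨x, hx, rfl⟩
    obtain ⟨y, hy, z, hz, rfl⟩ := mem_sup.1 hx
    exact ⟨of y, ⟨y, hy, rfl⟩, of z, ⟨z, hz, rfl⟩, (map_add _ _ _).symm⟩
  · rintro ⟨_, ⟨y, hy, rfl⟩, _, ⟨z, hz, rfl⟩, rfl⟩
    exact ⟨y + z, mem_sup.2 ⟨y, hy, z, hz, rfl⟩, map_add _ _ _⟩

/-- If `of i = of j`, then `i + idem j` and `idem i + j` share idempotent and class, so they are
equal. In a refinement of this equation the off-diagonal entries `b`, `c` lie in both ideals, and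
`of i = of b - of c` because `a + c = idem i` has class zero. -/
theorem subgroup_inf (I J : OrderIdeal M) : (I ⊓ J).subgroup = I.subgroup ⊓ J.subgroup := by
  ext g
  constructor
  · rintro ⟨x, hx, rfl⟩
    exact ⟨⟨x, hx.1, rfl⟩, ⟨x, hx.2, rfl⟩⟩
  · rintro ⟨⟨i, hi, rfl⟩, ⟨j, hj, hij⟩⟩
    have h : i + idem j = idem i + j := by
      refine ext_idem_of ?_ ?_
      · rw [idem_add, idem_add, idem_idem, idem_idem]
      · rw [map_add, map_add, of_idem, of_idem, hij, add_zero, zero_add]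
    obtain ⟨a, b, c, d, h1, h2, h3, h4⟩ := refinement (M := M) _ _ _ _ h
    have hb : b ∈ I ⊓ J := mem_inf.2 ⟨I.mem_of_algLE ⟨a, by rw [h1, add_comm]⟩ hi,
      J.mem_of_algLE ⟨d, h4.symm⟩ hj⟩
    have hc : c ∈ I ⊓ J := mem_inf.2 ⟨I.mem_of_algLE ⟨a, by rw [h3, add_comm]⟩ (I.idem_mem hi),
      J.mem_of_algLE ⟨d, h2.symm⟩ (J.idem_mem hj)⟩
    refine ⟨opp c + b, (I ⊓ J).add_mem ((I ⊓ J).opp_mem hc) hb, ?_⟩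
    have h5 : of a + of c = 0 := by rw [← map_add, ← h3, of_idem]
    rw [map_add, of_opp, h1, map_add, eq_neg_of_add_eq_zero_left h5]

/-- Represent `g` by `m` and `n • g` by `i` in `I`. Above the common idempotent `b = idem (m + i)`,
the equality of classes becomes `n • (m + b) = i + b` in `M`, to which (pur) applies for `idem i ≤
b`. -/
theorem subgroup_pure (I : OrderIdeal M) (n : ℕ) (hn : 0 < n) (g : Algebra.GrothendieckAddGroup M)
    (hg : n • g ∈ I.subgroup) : ∃ y ∈ I.subgroup, n • g = n • y := by
  obtain ⟨m, rfl⟩ := of_surjective g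
  obtain ⟨i, hi, hig⟩ := hg
  let b := idem (m + i)
  have hnb : n • b = b := by
    obtain ⟨k, rfl⟩ := Nat.exists_eq_succ_of_ne_zero hn.ne'
    clear hn hig
    induction k with
    | zero => rw [one_nsmul]
    | succ k ih => rw [succ_nsmul, ih, idem_add_idem]
  have hnm : idem (n • m) + b = b := by
    have h1 : idem m + b = b := by
      change idem m + idem (m + i) = idem (m + i)
      rw [idem_add, ← add_assoc, idem_add_idem]
    have h2 : ∀ k : ℕ, k • idem m + b = b := by
      intro k
      induction k with
      | zero => rw [zero_nsmul, zero_add]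
      | succ k ih => rw [succ_nsmul, add_assoc, h1, ih]
    rw [show idem (n • m) = n • idem m from map_nsmul idemHom n m, h2]
  have hib : idem i + b = b := by
    change idem i + idem (m + i) = idem (m + i)
    rw [idem_add, add_left_comm, idem_add_idem]
  have hb : idem (m + b) = b := by
    rw [idem_add, show idem b = b from idem_idem _]
    change idem m + idem (m + i) = idem (m + i)
    rw [idem_add, ← add_assoc, idem_add_idem]
  have heq : n • (m + b) = i + b := by
    refine ext_idem_of ?_ ?_
    · rw [nsmul_add, hnb, idem_add, idem_add, show idem b = b from idem_idem _, hnm, hib]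
    · rw [map_nsmul, map_add, map_add, hig, show of b = 0 from of_idem _, add_zero, add_zero]
  obtain ⟨_, ⟨y, hy, rfl⟩, hny⟩ := pur (M := M) (idem i) (idem_mem_idempotents i) b
    (idem_mem_idempotents _) ⟨b, hib⟩ n hn (m + b) (by
      have := mem_groupAt_idem (m + b)
      rwa [hb] at this) ⟨i, mem_groupAt_idem i, heq.symm⟩
  refine ⟨of y, ⟨y, I.mem_of_algLE hy.2 (I.idem_mem hi), rfl⟩, ?_⟩
  have := congrArg of hny
  simpa [map_nsmul, map_add, show of b = 0 from of_idem _] using this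

end OrderIdeal

/-! ### Homomorphisms into and out of groups with a zero adjoined -/

/-- The homomorphism to `WithZero A` that is given by `σ` where `Q` holds and is zero elsewhere. -/
noncomputable def WithZero.indicatorHom {S A : Type*} [AddCommMonoid S] [AddCommGroup A]
    (Q : S → Prop) (hQ0 : ¬ Q 0) (hQ : ∀ x y, Q (x + y) ↔ Q x ∨ Q y) (σ : S →+ A)
    (hσ : ∀ x, ¬ Q x → σ x = 0) : S →+ WithZero A := by
  classical
  exact
  { toFun := fun x => if Q x then WithZero.coe (σ x) else 0
    map_zero' := if_neg hQ0
    map_add' := fun x y => by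
      by_cases hx : Q x <;> by_cases hy : Q y
      · rw [if_pos hx, if_pos hy, if_pos ((hQ x y).2 (Or.inl hx)), map_add, WithZero.coe_add]
      · rw [if_pos hx, if_neg hy, if_pos ((hQ x y).2 (Or.inl hx)), map_add, hσ y hy, add_zero,
          add_zero]
      · rw [if_neg hx, if_pos hy, if_pos ((hQ x y).2 (Or.inr hy)), map_add, hσ x hx, zero_add,
          zero_add]
      · rw [if_neg hx, if_neg hy, if_neg (fun h => ((hQ x y).1 h).elim hx hy), zero_add] }

theorem WithZero.indicatorHom_apply {S A : Type*} [AddCommMonoid S] [AddCommGroup A]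
    {Q : S → Prop} (hQ0 : ¬ Q 0) (hQ : ∀ x y, Q (x + y) ↔ Q x ∨ Q y) (σ : S →+ A)
    (hσ : ∀ x, ¬ Q x → σ x = 0) (x : S) [Decidable (Q x)] :
    WithZero.indicatorHom Q hQ0 hQ σ hσ x = if Q x then WithZero.coe (σ x) else 0 := by
  simp only [WithZero.indicatorHom, AddMonoidHom.coe_mk, ZeroHom.coe_mk]
  congr

/-- Irreducible elements of a distributive lattice are prime. Since `p` is irreducible only in `L`,
both `a` and `b` must belong to `L`. -/
theorem SupIrred.coe_le_sup_iff {α : Type*} [DistribLattice α] {L : Sublattice α} {p : L}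
    (hp : SupIrred p) {a b : α} (ha : a ∈ L) (hb : b ∈ L) :
    (p : α) ≤ a ⊔ b ↔ (p : α) ≤ a ∨ (p : α) ≤ b :=
  (supPrime_iff_supIrred.2 hp).le_sup (b := ⟨a, ha⟩) (c := ⟨b, hb⟩)

namespace IsPureRefinementMonoid

variable {M : Type*} [AddCommMonoid M] [IsPureRefinementMonoid M]

/-- A homomorphism from a group into the group attached to an idempotent `c` yields a monoid
homomorphism after adjoining a zero to its source. -/
theorem exists_hom_withZero {A : Type*} [AddCommGroup A] {c : M} (hc : idem c = c)
    (τ : A →+ Algebra.GrothendieckAddGroup M)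
    (hτ : ∀ a, τ a ∈ (OrderIdeal.principal c).subgroup) :
    ∃ T : WithZero A →+ M, ∀ a : A, idem (T (WithZero.coe a)) = c ∧
      of (T (WithZero.coe a)) = τ a := by
  have hex : ∀ a, ∃ x : M, idem x = c ∧ of x = τ a := by
    intro a
    obtain ⟨x, hx, hxa⟩ := hτ a
    have hx' := algLE_iff.1 (OrderIdeal.mem_principal.1 hx)
    rw [hc] at hx'
    -- Adding `c` raises the idempotent to `c` and leaves the class unchanged.
    exact ⟨c + x, by rw [idem_add, hc, hx'], by rw [map_add, ← hc, of_idem, zero_add, hxa]⟩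
  choose t ht htτ using hex
  have hadd : ∀ a b, t (a + b) = t a + t b := fun a b => by
    refine ext_idem_of ?_ ?_
    · rw [idem_add, ht, ht, ht, ← hc, idem_add_idem]
    · rw [map_add, htτ, htτ, htτ, map_add]
  refine ⟨{ toFun := fun x => WithZero.recZeroCoe 0 t x, map_zero' := rfl, map_add' := ?_ },
    fun a => ⟨ht a, htτ a⟩⟩
  intro x y
  induction x using WithZero.recZeroCoe with
  | zero => simp
  | coe a =>
    induction y using WithZero.recZeroCoe with
    | zero => simp
    | coe b => rw [← WithZero.coe_add]; exact hadd a b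

theorem idem_eq_of_principal_eq {x y : M} (hxy : x ∈ OrderIdeal.principal y)
    (hyx : y ∈ OrderIdeal.principal x) : idem x = idem y := by
  have h1 := algLE_iff.1 (OrderIdeal.mem_principal.1 hxy)
  have h2 := algLE_iff.1 (OrderIdeal.mem_principal.1 hyx)
  rw [← h2, add_comm, h1]

end IsPureRefinementMonoid

/-! ### Finite lattices of ideals and the factorization of finitely generated submonoids -/

namespace OrderIdeal

variable {M : Type*} [AddCommMonoid M] [IsPureRefinementMonoid M]

theorem sum_mem {M : Type*} [AddCommMonoid M] (I : OrderIdeal M) {ι : Type*} {s : Finset ι}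
    {f : ι → M}
    (h : ∀ i ∈ s, f i ∈ I) : ∑ i ∈ s, f i ∈ I := I.1.sum_mem h

theorem subgroup_mono {I J : OrderIdeal M} (h : I ≤ J) : I.subgroup ≤ J.subgroup := by
  rintro _ ⟨x, hx, rfl⟩
  exact ⟨x, h hx, rfl⟩

/-- A finitely generated subgroup attached to an order ideal comes from a principal one. -/
theorem exists_le_subgroup_principal (I : OrderIdeal M)
    (D : AddSubgroup (Algebra.GrothendieckAddGroup M)) (hD : D.FG) (hDI : D ≤ I.subgroup) :
    ∃ c ∈ I, D ≤ (principal c).subgroup := by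
  classical
  obtain ⟨t, rfl⟩ := hD
  have h : ∀ t' ⊆ t, ∃ c ∈ I, ∀ g ∈ t', g ∈ (principal c).subgroup := by
    intro t'
    induction t' using Finset.induction_on with
    | empty => exact fun _ => ⟨0, I.zero_mem, by simp⟩
    | insert g t' _ ih =>
      intro ht
      rw [Finset.insert_subset_iff] at ht
      obtain ⟨c, hc, hct⟩ := ih ht.2
      obtain ⟨x, hx, rfl⟩ := hDI (AddSubgroup.subset_closure ht.1)
      refine ⟨x + c, I.add_mem hx hc, fun g hg => ?_⟩
      rw [principal_add]
      rcases Finset.mem_insert.1 hg with rfl | hg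
      · exact subgroup_mono le_sup_left ⟨x, mem_principal_self x, rfl⟩
      · exact subgroup_mono le_sup_right (hct g hg)
  obtain ⟨c, hc, hct⟩ := h t subset_rfl
  exact ⟨c, hc, (AddSubgroup.closure_le _).2 hct⟩

/-- In a finite sublattice of order ideals, the members of an ideal are sums of members of the
join-irreducible ideals below it. -/
theorem exists_sum_supIrred {L : Sublattice (OrderIdeal M)} [Fintype L]
    (hbot : (⊥ : OrderIdeal M) ∈ L) (a : L) :
    ∀ y ∈ a.1, ∃ d : L → M, (∀ p, d p ∈ p.1) ∧ (∀ p, ¬ (SupIrred p ∧ p ≤ a) → d p = 0) ∧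
      ∑ p, d p = y := by
  classical
  induction a using WellFoundedLT.induction with
  | ind a ih =>
  intro y hy
  by_cases ha : SupIrred a
  · refine ⟨Pi.single a y, fun p => ?_, fun p hp => ?_, ?_⟩
    · by_cases h : p = a
      · subst h; rwa [Pi.single_eq_same]
      · rw [Pi.single_eq_of_ne h]; exact zero_mem _
    · exact Pi.single_eq_of_ne (fun h : p = a => hp ⟨h.symm ▸ ha, h.le⟩) _
    · exact Fintype.sum_pi_single' a y
  · rcases not_supIrred.1 ha with h | ⟨b, c, rfl, hb, hc⟩
    · have hle : a ≤ ⟨⊥, hbot⟩ := h (show (⟨⊥, hbot⟩ : L) ≤ a from bot_le (a := a.1))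
      have : y = 0 := hle hy
      exact ⟨0, fun p => zero_mem _, fun _ _ => rfl, by simp [this]⟩
    · obtain ⟨y, hyb, z, hz, rfl⟩ := mem_sup.1 hy
      obtain ⟨d, hd, hd0, rfl⟩ := ih b hb y hyb
      obtain ⟨d', hd', hd0', rfl⟩ := ih c hc z hz
      refine ⟨d + d', fun p => p.1.add_mem (hd p) (hd' p), fun p hp => ?_,
        Finset.sum_add_distrib⟩
      rw [Pi.add_apply, hd0 p fun h => hp ⟨h.1, h.2.trans le_sup_left⟩,
        hd0' p fun h => hp ⟨h.1, h.2.trans le_sup_right⟩, add_zero]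

/-- Finitely many elements of a distributive lattice generate a finite sublattice. The ideal of a
sum is the join of the ideals, so the generators of the submonoid suffice. -/
theorem exists_sublattice_principal (X : Finset M) :
    ∃ L : Sublattice (OrderIdeal M), Finite L ∧ ⊥ ∈ L ∧
      ∀ x ∈ AddSubmonoid.closure (X : Set M), principal x ∈ L := by
  let L : Sublattice (OrderIdeal M) :=
    ⟨latticeClosure (insert ⊥ (principal '' (X : Set M))),
      isSublattice_latticeClosure.supClosed, isSublattice_latticeClosure.infClosed⟩
  have hbotL : (⊥ : OrderIdeal M) ∈ L := subset_latticeClosure (Set.mem_insert _ _)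
  refine ⟨L, ((X.finite_toSet.image _).insert ⊥).latticeClosure.to_subtype, hbotL, ?_⟩
  intro x hx
  induction hx using AddSubmonoid.closure_induction with
  | mem x hx => exact subset_latticeClosure (Set.mem_insert_of_mem _ ⟨x, hx, rfl⟩)
  | zero => rw [principal_zero]; exact hbotL
  | add x y _ _ hx hy => rw [principal_add]; exact L.supClosed hx hy

end OrderIdeal

namespace IsPureRefinementMonoid

variable {M : Type*} [AddCommMonoid M] [IsPureRefinementMonoid M]

open OrderIdeal

/-- The inclusion of a finitely generated submonoid factors through a finite direct sum of cyclic
groups with a zero adjoined, such that an order-unit has no zero component. -/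
theorem exists_factorization.{w} {M : Type w} [AddCommMonoid M] [IsPureRefinementMonoid M]
    {S : AddSubmonoid M} (hS : S.FG) {u : M} (hu : IsOrderUnit u)
    (huS : u ∈ S) :
    ∃ (K : Type w) (_ : Fintype K) (n : K → ℕ) (s : ∀ k, S →+ WithZero (ZMod (n k)))
      (T : ∀ k, WithZero (ZMod (n k)) →+ M),
      (∀ x : S, ∑ k, T k (s k x) = x) ∧ ∀ k, s k ⟨u, huS⟩ ≠ 0 := by
  classical
  obtain ⟨X, rfl⟩ := hS
  -- the finite lattice of order ideals and the finitely generated group generated by `X`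
  obtain ⟨L, hfin, hbotL, hprL⟩ := exists_sublattice_principal X
  have := Fintype.ofFinite L
  let _ : OrderBot L := { bot := ⟨⊥, hbotL⟩, bot_le := fun a => bot_le (a := a.1) }
  let Γ : AddSubgroup (Algebra.GrothendieckAddGroup M) :=
    AddSubgroup.closure ((X.image of : Finset (Algebra.GrothendieckAddGroup M)) : Set _)
  have hΓ : AddSubmonoid.closure (X : Set M) ≤ Γ.toAddSubmonoid.comap of := by
    refine (AddSubmonoid.closure_le).2 fun x hx => AddSubgroup.subset_closure ?_
    simpa using ⟨x, hx, rfl⟩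
  let σ : AddSubmonoid.closure (X : Set M) →+ Γ :=
    { toFun := fun x => ⟨of x.1, hΓ x.2⟩
      map_zero' := Subtype.ext (map_zero of)
      map_add' := fun x y => Subtype.ext (map_add of _ _) }
  have huΓ : ∀ x : Γ, Γ.subtype x ∈ (principal u).subgroup := by
    intro x
    obtain ⟨m, hm⟩ := of_surjective (x : Algebra.GrothendieckAddGroup M)
    obtain ⟨k, hk⟩ := hu m
    exact ⟨m, mem_of_algLE _ hk ((principal u).1.nsmul_mem (mem_principal_self u) k), hm⟩
  obtain ⟨θ, hθ, hθirr, hθsum, hθ0⟩ := AddMonoidHom.exists_supIrred_decomposition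
    (fun a : L => a.1.subgroup) subgroup_bot (fun a b => subgroup_sup _ _)
    (fun a b => subgroup_inf _ _) (fun a => subgroup_pure _) ⟨principal u, hprL u huS⟩
    Γ.subtype huΓ
  -- cyclic decompositions of the pieces
  choose J hJ hJd hJn n α β hβα using
    fun p : L => AddGroup.FG.exists_retract_zmod (θ p).range
  -- large idempotents in the irreducible ideals
  have hd : ∀ x : X, ∃ d : L → M, (∀ p, d p ∈ p.1) ∧
      (∀ p : L, ¬ (SupIrred p ∧ p.1 ≤ principal x.1) → d p = 0) ∧ ∑ p, d p = x.1 := fun x =>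
    exists_sum_supIrred hbotL ⟨principal x.1, hprL x (AddSubmonoid.subset_closure x.2)⟩ x.1
      (mem_principal_self _)
  choose d hdp hd0 hdsum using hd
  -- The idempotent `c` must be large enough to carry the image of `θ p` and to dominate the
  -- `p`-parts of all generators. Finiteness of both data lets it stay inside `p`.
  have hc : ∀ p : L, ∃ c ∈ p.1, idem c = c ∧ (θ p).range ≤ (principal c).subgroup ∧
      ∀ x, d x p ∈ principal c := by
    intro p
    obtain ⟨c, hc, hcθ⟩ := exists_le_subgroup_principal p.1 (θ p).range
      ((AddGroup.fg_iff_addSubgroup_fg _).1 inferInstance)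
      (by rintro _ ⟨x, rfl⟩; exact hθ p x)
    have hmem : c + ∑ x, d x p ∈ p.1 := add_mem _ hc (sum_mem _ fun x _ => hdp x p)
    have hle : principal (c + ∑ x, d x p) ≤ principal (idem (c + ∑ x, d x p)) :=
      principal_le.2 (by rw [mem_principal, idem_idem]; exact algLE_idem _)
    refine ⟨idem (c + ∑ x, d x p), idem_mem _ hmem, idem_idem _, hcθ.trans (subgroup_mono ?_),
      fun x => hle ?_⟩
    · exact le_trans (by rw [principal_add]; exact le_sup_left) hle
    · refine mem_of_algLE _ ?_ (mem_principal_self _)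
      rw [← Finset.add_sum_erase _ _ (Finset.mem_univ x), add_left_comm]
      exact ⟨_, rfl⟩
  choose c hcp hcc hcθ hcd using hc
  have hT : ∀ (p : L) (j : J p), ∃ T : WithZero (ZMod (n p j)) →+ M, ∀ a,
      idem (T (WithZero.coe a)) = c p ∧
        of (T (WithZero.coe a)) = ((β p (Pi.single j a) : (θ p).range) : _) := fun p j =>
    exists_hom_withZero (hcc p) ((θ p).range.subtype.comp
      ((β p).comp (AddMonoidHom.single (fun j => ZMod (n p j)) j)))
      fun a => hcθ p (β p (Pi.single j a)).2
  choose T hTidem hTof using hT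
  let P := { p : L // SupIrred p }
  let Q : P → AddSubmonoid.closure (X : Set M) → Prop := fun p x => p.1.1 ≤ principal x.1
  have hQ0 : ∀ p, ¬ Q p 0 := by
    intro p h
    refine p.2.1 fun q _ => ?_
    have h : p.1.1 ≤ ⊥ := principal_zero (M := M) ▸ h
    exact h.trans bot_le
  have hQ : ∀ p x y, Q p (x + y) ↔ Q p x ∨ Q p y := by
    intro p x y
    change p.1.1 ≤ principal (x.1 + y.1) ↔ _
    rw [principal_add]
    exact p.2.coe_le_sup_iff (hprL _ x.2) (hprL _ y.2)
  have hQθ : ∀ (p : P) x, ¬ Q p x → θ p.1 (σ x) = 0 := fun p x h =>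
    hθ0 ⟨principal x.1, hprL _ x.2⟩ p.1 (σ x) ⟨x.1, mem_principal_self _, rfl⟩ h
  let ρ : ∀ (p : P) (j : J p.1), AddSubmonoid.closure (X : Set M) →+ ZMod (n p.1 j) :=
    fun p j => (Pi.evalAddMonoidHom _ j).comp ((α p.1).comp ((θ p.1).rangeRestrict.comp σ))
  have hρ : ∀ p j x, ¬ Q p x → ρ p j x = 0 := by
    intro p j x h
    have : (θ p.1).rangeRestrict (σ x) = 0 := Subtype.ext (hQθ p x h)
    simp [ρ, this]
  let s : ∀ k : (Σ p : P, J p.1), AddSubmonoid.closure (X : Set M) →+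
      WithZero (ZMod (n k.1.1 k.2)) :=
    fun k => WithZero.indicatorHom (Q k.1) (hQ0 _) (hQ _) (ρ k.1 k.2) (hρ _ _)
  have hs : ∀ k x, s k x = if Q k.1 x then WithZero.coe (ρ k.1 k.2 x) else 0 :=
    fun k x => WithZero.indicatorHom_apply _ _ _ _ _
  refine ⟨Σ p : P, J p.1, inferInstance, fun k => n k.1.1 k.2, s, fun k => T k.1.1 k.2, ?_, ?_⟩
  swap
  · intro k
    have : Q k.1 ⟨u, huS⟩ := fun y _ => by
      obtain ⟨m, hm⟩ := hu y
      exact mem_of_algLE _ hm ((principal u).1.nsmul_mem (mem_principal_self u) m)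
    rw [hs, if_pos this]
    exact WithZero.coe_ne_zero
  -- Classes agree on all of `S`: the components at `p` add up to `θ p (σ x)`, also where the
  -- indicator is zero, since `θ p` vanishes there.
  have hof : ∀ x, of (∑ k : (Σ p : P, J p.1), T k.1.1 k.2 (s k x)) = of x.1 := by
    intro x
    rw [map_sum, Fintype.sum_sigma]
    have h1 : ∀ p : P, ∑ j, of (T p.1 j (s ⟨p, j⟩ x)) = θ p.1 (σ x) := by
      intro p
      by_cases h : Q p x
      · have h2 : ∀ j, of (T p.1 j (s ⟨p, j⟩ x)) =
            (θ p.1).range.subtype (β p.1 (Pi.single j (ρ p j x))) := fun j => by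
          rw [hs, if_pos h]
          exact hTof _ _ _
        simp only [h2]
        rw [← map_sum, ← map_sum, Finset.univ_sum_single]
        change (θ p.1).range.subtype (β p.1 (α p.1 ((θ p.1).rangeRestrict (σ x)))) = _
        rw [hβα]
        rfl
      · rw [hQθ p x h]
        refine Finset.sum_eq_zero fun j _ => ?_
        rw [hs, if_neg h, map_zero, map_zero]
    simp only [h1]
    refine Eq.trans ?_ (hθsum (σ x))
    rw [← Finset.sum_subtype (Finset.univ.filter fun p : L => SupIrred p) (by simp)
      (fun p => θ p (σ x))]
    refine Finset.sum_filter_of_ne fun p _ hp => ?_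
    by_contra h
    exact hp (by rw [hθirr p h]; rfl)
  let F : AddSubmonoid.closure (X : Set M) →+ M := ∑ k, (T k.1.1 k.2).comp (s k)
  have hF : ∀ x, F x = ∑ k : (Σ p : P, J p.1), T k.1.1 k.2 (s k x) := fun x => by simp [F]
  have hX : ∀ x (hx : x ∈ (X : Set M)), F ⟨x, AddSubmonoid.subset_closure hx⟩ = x := by
    intro x hx
    -- For idempotents, `F x` lies in the ideal of `x` because only `c p` with `p ≤ principal x`
    -- occur. Conversely, `x` is the sum of its parts `d x p`, each dominated by a `c p` that does
    -- occur.
    refine ext_idem_of (idem_eq_of_principal_eq ?_ ?_) ((hF _).symm ▸ hof _)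
    · rw [hF]
      refine sum_mem _ fun k _ => ?_
      rw [hs]
      split_ifs with h
      · have hk : c k.1.1 ∈ principal x := h (hcp k.1.1)
        exact mem_of_algLE _ (hTidem k.1.1 k.2 _ ▸ algLE_idem _) hk
      · rw [map_zero]
        exact OrderIdeal.zero_mem _
    · have hmem : ∑ p, d ⟨x, hx⟩ p ∈ principal (F ⟨x, AddSubmonoid.subset_closure hx⟩) := by
        refine sum_mem _ fun p _ => ?_
        by_cases hp : SupIrred p ∧ p.1 ≤ principal x
        -- Nonemptiness of `J p` is essential: even if `θ p = 0`, some summand must record the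
        -- idempotent `c p`.
        · obtain ⟨j⟩ := hJn p
          refine (?_ : principal (c p) ≤ _) (hcd p ⟨x, hx⟩)
          rw [principal_le, mem_principal, hF]
          have h1 : AlgLE (T p j (s ⟨⟨p, hp.1⟩, j⟩ ⟨x, AddSubmonoid.subset_closure hx⟩))
              (∑ k : (Σ p : P, J p.1), T k.1.1 k.2 (s k ⟨x, AddSubmonoid.subset_closure hx⟩)) :=
            ⟨_, Finset.add_sum_erase _ (fun k : (Σ p : P, J p.1) => T k.1.1 k.2 (s k _))
              (Finset.mem_univ ⟨⟨p, hp.1⟩, j⟩)⟩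
          rw [hs, if_pos hp.2] at h1
          have h2 := hTidem p j (ρ ⟨p, hp.1⟩ j ⟨x, AddSubmonoid.subset_closure hx⟩)
          exact ((h2 ▸ idem_algLE _).trans h1).trans (algLE_idem _)
        · rw [hd0 _ p hp]
          exact OrderIdeal.zero_mem _
      rwa [hdsum] at hmem
  intro x
  rw [← hF]
  obtain ⟨x, hx⟩ := x
  induction hx using AddSubmonoid.closure_induction with
  | mem x hx => exact hX x hx
  | zero => exact map_zero F
  | add x y hx hy ihx ihy =>
    refine (map_add F ⟨x, hx⟩ ⟨y, hy⟩).trans ?_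
    rw [ihx, ihy]

end IsPureRefinementMonoid

/-! ### From factorizations to a direct limit -/

instance WithZero.addMonoid_fg {A : Type*} [AddCommGroup A] [AddGroup.FG A] :
    AddMonoid.FG (WithZero A) := by
  classical
  obtain ⟨X, hX⟩ := (AddMonoid.fg_def (M := A)).1 (AddGroup.fg_iff_addMonoid_fg.1 inferInstance)
  -- The zero of `A` is no longer neutral in `WithZero A`, so it is added as a generator of its own.
  refine AddMonoid.fg_def.2 ⟨insert ((0 : A) : WithZero A) (X.image WithZero.coe), ?_⟩
  rw [eq_top_iff]
  rintro x -
  induction x using WithZero.recZeroCoe with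
  | zero => exact AddSubmonoid.zero_mem _
  | coe a =>
    have ha : a ∈ AddSubmonoid.closure (X : Set A) := hX ▸ AddSubmonoid.mem_top a
    induction ha using AddSubmonoid.closure_induction with
    | mem a ha =>
      exact AddSubmonoid.subset_closure (Finset.mem_insert_of_mem (Finset.mem_image_of_mem _ ha))
    | zero => exact AddSubmonoid.subset_closure (Finset.mem_insert_self _ _)
    | add a b _ _ ha hb => exact WithZero.coe_add a b ▸ AddSubmonoid.add_mem _ ha hb

/-- A finitely generated submonoid containing `u`, together with a level that makes the index set
of a direct system of such submonoids a partially ordered set. -/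
structure StageIndex {M : Type*} [AddCommMonoid M] (u : M) where
  carrier : AddSubmonoid M
  fg : carrier.FG
  mem : u ∈ carrier
  level : ℕ

/-- If the inclusions of all finitely generated submonoids containing `u` factor through finite
sums of pointed cyclic groups with a zero adjoined, then `(M, u)` is a direct limit of these. -/
theorem isDirectLimitOfPointedCyclicSums_of_factorizations.{w} {M : Type w} [AddCommMonoid M]
    {u : M} (G : StageIndex u → Type w) [∀ i, AddCommMonoid (G i)] [∀ i, AddMonoid.FG (G i)]
    (s : ∀ i : StageIndex u, i.carrier →+ G i) (ψ : ∀ i, G i →+ M)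
    (hs : ∀ (i : StageIndex u) (x : i.carrier), ψ i (s i x) = x)
    (hG : ∀ i, IsFiniteSumOfPointedCyclic (G i) (s i ⟨u, i.mem⟩)) :
    IsDirectLimitOfPointedCyclicSums M u := by
  classical
  have hle : ∀ i, i.carrier ≤ AddMonoidHom.mrange (ψ i) := fun i x hx => ⟨s i ⟨x, hx⟩, hs i _⟩
  -- Since `s i ∘ ψ i` need not be the identity, distinct stages must not be comparable in both
  -- directions. The strict increase of levels ensures this.
  let P : Preorder (StageIndex u) :=
    { le := fun i j => i = j ∨ i.level < j.level ∧ AddMonoidHom.mrange (ψ i) ≤ j.carrier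
      le_refl := fun i => Or.inl rfl
      le_trans := by
        rintro i j k (rfl | h) (rfl | h')
        · exact Or.inl rfl
        · exact Or.inr h'
        · exact Or.inr h
        · exact Or.inr ⟨h.1.trans h'.1, h.2.trans ((hle j).trans h'.2)⟩ }
  let f : ∀ i j, i ≤ j → G i →+ G j := fun i j h =>
    if e : i = j then e ▸ AddMonoidHom.id (G i)
    else (s j).comp ((ψ i).codRestrict j.carrier fun x => (h.resolve_left e).2 ⟨x, rfl⟩)
  have f_self : ∀ i (h : i ≤ i) x, f i i h x = x := fun i h x => by simp [f]
  have f_ne : ∀ i j (h : i ≤ j) (e : i ≠ j) x,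
      f i j h x = s j ⟨ψ i x, (h.resolve_left e).2 ⟨x, rfl⟩⟩ := fun i j h e x => by
    simp only [f, dif_neg e]
    rfl
  have ψ_f : ∀ i j (h : i ≤ j) x, ψ j (f i j h x) = ψ i x := by
    intro i j h x
    by_cases e : i = j
    · subst e; rw [f_self i h]
    · rw [f_ne i j h e, hs]
  have hf : DirectedSystem G (f · · ·) :=
    { map_self := fun i x => f_self i le_rfl x
      map_map := by
        intro k j i hij hjk x
        by_cases e : i = j
        · subst e; rw [f_self i hij]
        by_cases e' : j = k
        · subst e'; rw [f_self j hjk]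
        -- A loop `i < j < i` would require a nontrivial composite to be the identity; the levels
        -- rule it out.
        have e'' : i ≠ k := by
          rintro rfl
          exact lt_asymm (hij.resolve_left e).1 (hjk.resolve_left e').1
        rw [f_ne j k hjk e', f_ne i k (hij.trans hjk) e'']
        congr 2
        exact ψ_f i j hij x }
  have hdir : ∀ i j : StageIndex u, ∀ S : AddSubmonoid M, S.FG → ∃ k, i ≤ k ∧ j ≤ k ∧ i ≠ k ∧
      S ≤ k.carrier := by
    intro i j S hS
    have hfg : ∀ i, (AddMonoidHom.mrange (ψ i)).FG := fun i =>
      (AddMonoid.fg_iff_addSubmonoid_fg _).1 inferInstance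
    let k : StageIndex u := ⟨AddMonoidHom.mrange (ψ i) ⊔ AddMonoidHom.mrange (ψ j) ⊔ S,
      ((hfg i).sup (hfg j)).sup hS,
      (le_sup_of_le_left le_sup_left : AddMonoidHom.mrange (ψ i) ≤ _) (hle i i.mem),
      max i.level j.level + 1⟩
    have hi : i.level < k.level := Nat.lt_succ_of_le (le_max_left _ _)
    have hj : j.level < k.level := Nat.lt_succ_of_le (le_max_right _ _)
    refine ⟨k, Or.inr ⟨hi, le_sup_of_le_left le_sup_left⟩,
      Or.inr ⟨hj, le_sup_of_le_left le_sup_right⟩, ?_, le_sup_right⟩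
    intro h
    rw [← h] at hi
    exact lt_irrefl _ hi
  let i₀ : StageIndex u := ⟨AddSubmonoid.closure {u}, ⟨{u}, by simp⟩,
    AddSubmonoid.subset_closure rfl, 0⟩
  have hID : IsDirectedOrder (StageIndex u) := ⟨fun i j => by
    obtain ⟨k, hik, hjk, -⟩ := hdir i j ⊥ AddSubmonoid.FG.bot
    exact ⟨k, hik, hjk⟩⟩
  have hne : Nonempty (StageIndex u) := ⟨i₀⟩
  refine ⟨StageIndex u, P, hID, hne, G, inferInstance, fun i => s i ⟨u, i.mem⟩, f, hf, hG, ?_, ?_⟩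
  · intro i j h
    by_cases e : i = j
    · subst e; rw [f_self i h]
    · rw [f_ne i j h e]
      congr 2
      exact hs i _
  let Φ : DirectLimit G f →+ M :=
    { toFun := DirectLimit.lift f (fun i => ψ i) (fun i j h x => (ψ_f i j h x).symm)
      map_zero' := by
        rw [DirectLimit.zero_def i₀]
        exact map_zero (ψ i₀)
      map_add' := DirectLimit.induction₂ _ fun i x y => by
        rw [DirectLimit.add_def]
        exact map_add (ψ i) x y }
  have hΦ : ∀ i x, Φ ⟦⟨i, x⟩⟧ = ψ i x := fun i x => rfl
  refine ⟨AddEquiv.ofBijective Φ ⟨?_, ?_⟩, fun i => ?_⟩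
  · intro x y
    refine DirectLimit.induction₂ (f := f) (C := fun x y => Φ x = Φ y → x = y) ?_ x y
    intro i x y hxy
    rw [hΦ, hΦ] at hxy
    -- Passing to a strictly later stage factors through `ψ i`, so elements with equal image in `M`
    -- become equal there.
    obtain ⟨k, hik, -, e, -⟩ := hdir i i ⊥ AddSubmonoid.FG.bot
    rw [← DirectLimit.mk_apply i k x hik, ← DirectLimit.mk_apply i k y hik, f_ne i k hik e,
      f_ne i k hik e]
    simp only [hxy]
  · intro x
    obtain ⟨k, -, -, -, hk⟩ := hdir i₀ i₀ (AddSubmonoid.closure {x}) ⟨{x}, by simp⟩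
    exact ⟨⟦⟨k, s k ⟨x, hk (AddSubmonoid.subset_closure rfl)⟩⟩⟧, hs k _⟩
  · exact hs i _

theorem IsPureRefinementMonoid.isDirectLimitOfPointedCyclicSums.{w} {M : Type w} [AddCommMonoid M]
    [IsPureRefinementMonoid M] {u : M} (hu : IsOrderUnit u) :
    IsDirectLimitOfPointedCyclicSums M u := by
  have h : ∀ i : StageIndex u, ∃ (r : ℕ) (n : Fin r → ℕ) (m : Fin r → ℤ)
      (s : i.carrier →+ ∀ k, WithZero (ZMod (n k))) (ψ : (∀ k, WithZero (ZMod (n k))) →+ M),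
      (∀ x, ψ (s x) = x) ∧
        s ⟨u, i.mem⟩ = fun k => WithZero.coe (Int.cast (m k) : ZMod (n k)) := by
    intro i
    obtain ⟨K, _, n, s, T, hs, hsu⟩ := exists_factorization i.fg hu i.mem
    let e := (Fintype.equivFin K).symm
    have hm : ∀ k, ∃ m : ℤ, s k ⟨u, i.mem⟩ = WithZero.coe (Int.cast m : ZMod (n k)) := by
      intro k
      obtain ⟨a, ha⟩ := WithZero.ne_zero_iff_exists.1 (hsu k)
      obtain ⟨m, rfl⟩ := ZMod.intCast_surjective a
      exact ⟨m, ha.symm⟩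
    choose m hm using hm
    refine ⟨_, fun k => n (e k), fun k => m (e k), AddMonoidHom.pi fun k => s (e k),
      ∑ k, (T (e k)).comp (Pi.evalAddMonoidHom _ k), fun x => ?_, funext fun k => hm (e k)⟩
    rw [← hs x, ← e.sum_comp]
    simp
  choose r n m s ψ hs hsu using h
  -- Lifting places the stages in the universe of `M`.
  let E (i : StageIndex u) : ULift.{w} (∀ k, WithZero (ZMod (n i k))) ≃+
    ∀ k, WithZero (ZMod (n i k)) := AddEquiv.ulift
  have (d : ℕ) : AddGroup.FG (ZMod d) :=
    AddGroup.fg_of_surjective (f := Int.castAddHom (ZMod d)) ZMod.intCast_surjective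
  have (i : StageIndex u) : AddMonoid.FG (ULift.{w} (∀ k, WithZero (ZMod (n i k)))) :=
    AddMonoid.fg_of_surjective (E i).symm.toAddMonoidHom (E i).symm.surjective
  exact isDirectLimitOfPointedCyclicSums_of_factorizations
    (fun i => ULift.{w} (∀ k, WithZero (ZMod (n i k))))
    (fun i => (E i).symm.toAddMonoidHom.comp (s i))
    (fun i => (ψ i).comp (E i).toAddMonoidHom) (fun i x => hs i x)
    fun i => ⟨r i, n i, m i, E i, hsu i⟩

/-! ### The converse: stability of the axioms under products and direct limits -/

/-- A variant of `IsPureRefinementMonoid` whose axioms are visibly preserved by finite products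
and direct limits. -/
structure IsLimitStableRefinementMonoid (M : Type*) [AddCommMonoid M] : Prop where
  regular : ∀ x : M, ∃ z, x + x + z = x
  conical : ∀ x y : M, x + y = 0 → x = 0
  refinement : IsRefinementMonoid M
  -- The second element is written `x + z`, and `w` witnesses that it lies in the group of `x`. No
  -- idempotent has to be named.
  emb : ∀ x z w b : M, x + z + w = x → x + b = x + z + b → x = x + z
  -- The witnesses `v`, `w` say `y ≤ z ≤ y`, so `y` lies in the same group as `z`.
  pur : ∀ n : ℕ, 0 < n → ∀ x b z : M, b + b = b → n • x = z + b →
    ∃ y v w, n • (y + b) = n • x ∧ y + v = z ∧ z + w = y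

namespace IsLimitStableRefinementMonoid

theorem isPureRefinementMonoid {M : Type*} [AddCommMonoid M] (h : IsLimitStableRefinementMonoid M) :
    IsPureRefinementMonoid M where
  regular x := by
    obtain ⟨z, hz⟩ := h.regular x
    exact ⟨z, by rw [two_nsmul, hz]⟩
  conical x y hxy := ⟨h.conical x y hxy, h.conical y x (by rw [add_comm, hxy])⟩
  refinement := h.refinement
  emb := by
    rintro a - b - - x hx y hy hxy
    obtain ⟨z, hz⟩ := hx.2.trans hy.1
    obtain ⟨w, hw⟩ := hy.2.trans hx.1
    subst hz
    exact h.emb x z w b hw hxy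
  pur := by
    rintro a ha b hb - n hn x - ⟨z, hz, hzx⟩
    obtain ⟨y, v, w, hy, hv, hw⟩ := h.pur n hn x b z (by rw [← two_nsmul]; exact hb) hzx.symm
    exact ⟨y + b, ⟨y, ⟨hz.1.trans ⟨w, hw⟩, AlgLE.trans ⟨v, hv⟩ hz.2⟩, rfl⟩, hy.symm⟩

theorem withZero (A : Type*) [AddCommGroup A] : IsLimitStableRefinementMonoid (WithZero A) where
  regular x := by
    induction x using WithZero.recZeroCoe with
    | zero => exact ⟨0, by simp⟩
    | coe a => exact ⟨((-a : A) : WithZero A), by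
        rw [← WithZero.coe_add, ← WithZero.coe_add, add_neg_cancel_right]⟩
  conical x y h := by
    induction x using WithZero.recZeroCoe with
    | zero => rfl
    | coe a =>
      induction y using WithZero.recZeroCoe with
      | zero => rwa [add_zero] at h
      | coe b => exact absurd h WithZero.coe_ne_zero
  refinement := by
    intro a₀ a₁ b₀ b₁ h
    induction a₀ using WithZero.recZeroCoe with
    | zero => exact ⟨0, 0, b₀, b₁, by simp, by simpa using h, by simp, by simp⟩
    | coe a₀ =>
    induction a₁ using WithZero.recZeroCoe with
    | zero => exact ⟨b₀, b₁, 0, 0, by simpa using h, by simp, by simp, by simp⟩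
    | coe a₁ =>
    induction b₀ using WithZero.recZeroCoe with
    | zero => exact ⟨0, a₀, 0, a₁, by simp, by simp, by simp, by simpa using h.symm⟩
    | coe b₀ =>
    induction b₁ using WithZero.recZeroCoe with
    | zero => exact ⟨a₀, 0, a₁, 0, by simp, by simp, by simpa using h.symm, by simp⟩
    | coe b₁ =>
      rw [← WithZero.coe_add, ← WithZero.coe_add, WithZero.coe_inj] at h
      -- When all four elements lie in the group, subtraction gives a refinement whose `0` is the
      -- zero of `A`.
      refine ⟨a₀, (0 : A), (b₀ - a₀ : A), b₁, ?_, ?_, ?_, ?_⟩ <;>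
        rw [← WithZero.coe_add, WithZero.coe_inj]
      · rw [add_zero]
      · rw [← add_right_inj a₀, h]; abel
      · abel
      · rw [zero_add]
  emb x z w b h h' := by
    induction z using WithZero.recZeroCoe with
    | zero => rw [add_zero]
    | coe z =>
    induction x using WithZero.recZeroCoe with
    | zero =>
      induction w using WithZero.recZeroCoe with
      | zero => simp at h
      | coe w =>
        rw [zero_add, ← WithZero.coe_add] at h
        exact absurd h WithZero.coe_ne_zero
    | coe x =>
    induction b using WithZero.recZeroCoe with
    | zero => simpa using h'
    | coe b =>
      simp only [← WithZero.coe_add, WithZero.coe_inj] at h' ⊢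
      exact add_right_cancel h'
  pur n hn x b z hb h := by
    induction z using WithZero.recZeroCoe with
    | zero => exact ⟨0, 0, 0, by
        rw [h, zero_add]
        obtain ⟨k, rfl⟩ := Nat.exists_eq_succ_of_ne_zero hn.ne'
        clear hn h
        induction k with
        | zero => rw [one_nsmul]
        | succ k ih => rw [succ_nsmul, ih, hb], by simp, by simp⟩
    | coe z =>
    induction x using WithZero.recZeroCoe with
    | zero =>
      rw [smul_zero] at h
      induction b using WithZero.recZeroCoe with
      | zero => exact absurd h.symm (by simp)
      | coe b => exact absurd h.symm WithZero.coe_ne_zero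
    | coe x =>
      refine ⟨x, ((z - x : A) : WithZero A), ((x - z : A) : WithZero A), ?_, ?_, ?_⟩
      · induction b using WithZero.recZeroCoe with
        | zero => rw [add_zero]
        | coe b =>
          have hb0 : b = 0 := by
            rw [← WithZero.coe_add, WithZero.coe_inj] at hb
            simpa using hb
          rw [hb0, ← WithZero.coe_add, add_zero]
      · rw [← WithZero.coe_add, add_sub_cancel]
      · rw [← WithZero.coe_add, add_sub_cancel]

theorem pi {ι : Type*} {A : ι → Type*} [∀ i, AddCommMonoid (A i)]
    (h : ∀ i, IsLimitStableRefinementMonoid (A i)) : IsLimitStableRefinementMonoid (∀ i, A i) where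
  regular x := by
    choose z hz using fun i => (h i).regular (x i)
    exact ⟨z, funext hz⟩
  conical x y hxy := funext fun i => (h i).conical _ _ (congrFun hxy i)
  refinement a₀ a₁ b₀ b₁ hab := by
    choose c₀₀ c₀₁ c₁₀ c₁₁ h₁ h₂ h₃ h₄ using fun i =>
      (h i).refinement _ _ _ _ (congrFun hab i)
    exact ⟨c₀₀, c₀₁, c₁₀, c₁₁, funext h₁, funext h₂, funext h₃, funext h₄⟩
  emb x z w b h₁ h₂ := funext fun i => (h i).emb _ _ _ _ (congrFun h₁ i) (congrFun h₂ i)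
  pur n hn x b z hb hx := by
    choose y v w h₁ h₂ h₃ using fun i =>
      (h i).pur n hn _ _ _ (congrFun hb i) (congrFun hx i)
    exact ⟨y, v, w, funext h₁, funext h₂, funext h₃⟩

/-- The axioms pass to a monoid covered by a directed family of homomorphisms that identify only
elements already identified at a later stage. -/
theorem of_directed {M I : Type*} [AddCommMonoid M] [Preorder I] [IsDirectedOrder I] [Nonempty I]
    {G : I → Type*} [∀ i, AddCommMonoid (G i)] (f : ∀ i j, i ≤ j → G i →+ G j)
    (g : ∀ i, G i →+ M) (hg : ∀ i j h x, g j (f i j h x) = g i x)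
    (hsurj : ∀ x, ∃ i y, g i y = x)
    (hsep : ∀ i x y, g i x = g i y → ∃ j h, f i j h x = f i j h y)
    (hG : ∀ i, IsLimitStableRefinementMonoid (G i)) : IsLimitStableRefinementMonoid M := by
  -- Each axiom involves at most four given elements, so they all lift to one stage; shorter lists
  -- are padded with zeros.
  have lift : ∀ x : Fin 4 → M, ∃ i, ∃ y : Fin 4 → G i, ∀ k, g i (y k) = x k := by
    intro x
    choose i y hy using fun k => hsurj (x k)
    obtain ⟨j, hj⟩ := Finite.exists_le i
    exact ⟨j, fun k => f _ _ (hj k) (y k), fun k => by rw [hg, hy]⟩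
  refine ⟨fun x => ?_, fun x y h => ?_, fun a₀ a₁ b₀ b₁ h => ?_, fun x z w b h₁ h₂ => ?_,
    fun n hn x b z h₁ h₂ => ?_⟩
  · obtain ⟨i, x, rfl⟩ := hsurj x
    obtain ⟨z, hz⟩ := (hG i).regular x
    exact ⟨g i z, by rw [← map_add, ← map_add, hz]⟩
  · obtain ⟨i, v, hv⟩ := lift ![x, y, 0, 0]
    obtain rfl : g i (v 0) = x := hv 0
    obtain rfl : g i (v 1) = y := hv 1
    rw [← map_add, ← map_zero (g i)] at h
    obtain ⟨j, hij, h⟩ := hsep _ _ _ h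
    rw [map_add, map_zero] at h
    rw [← hg i j hij, (hG j).conical _ _ h, map_zero]
  · obtain ⟨i, v, hv⟩ := lift ![a₀, a₁, b₀, b₁]
    obtain rfl : g i (v 0) = a₀ := hv 0
    obtain rfl : g i (v 1) = a₁ := hv 1
    obtain rfl : g i (v 2) = b₀ := hv 2
    obtain rfl : g i (v 3) = b₁ := hv 3
    rw [← map_add, ← map_add] at h
    obtain ⟨j, hij, h⟩ := hsep _ _ _ h
    rw [map_add, map_add] at h
    obtain ⟨c₀₀, c₀₁, c₁₀, c₁₁, h₁, h₂, h₃, h₄⟩ := (hG j).refinement _ _ _ _ h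
    refine ⟨g j c₀₀, g j c₀₁, g j c₁₀, g j c₁₁, ?_, ?_, ?_, ?_⟩ <;>
      rw [← map_add, ← hg i j hij] <;> congr 1
  · obtain ⟨i, v, hv⟩ := lift ![x, z, w, b]
    obtain rfl : g i (v 0) = x := hv 0
    obtain rfl : g i (v 1) = z := hv 1
    obtain rfl : g i (v 2) = w := hv 2
    obtain rfl : g i (v 3) = b := hv 3
    simp only [← map_add] at h₁ h₂ ⊢
    obtain ⟨j, hij, h₁⟩ := hsep _ _ _ h₁
    rw [← hg i j hij, ← hg i j hij] at h₂
    -- Two hypotheses need two successive stages, and the first equation is then pushed forward to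
    -- the second stage.
    obtain ⟨k, hjk, h₂⟩ := hsep _ _ _ h₂
    have h₁ := congrArg (f j k hjk) h₁
    simp only [map_add] at h₁ h₂
    rw [← hg i j hij, ← hg j k hjk, (hG k).emb _ _ _ _ h₁ h₂, ← map_add, ← map_add, hg, hg]
  · obtain ⟨i, v, hv⟩ := lift ![x, b, z, 0]
    obtain rfl : g i (v 0) = x := hv 0
    obtain rfl : g i (v 1) = b := hv 1
    obtain rfl : g i (v 2) = z := hv 2
    simp only [← map_add, ← map_nsmul] at h₁ h₂ ⊢
    obtain ⟨j, hij, h₁⟩ := hsep _ _ _ h₁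
    rw [← hg i j hij, ← hg i j hij] at h₂
    obtain ⟨k, hjk, h₂⟩ := hsep _ _ _ h₂
    have h₁ := congrArg (f j k hjk) h₁
    simp only [map_add, map_nsmul] at h₁ h₂
    obtain ⟨y, p, q, hy, hp, hq⟩ := (hG k).pur n hn _ _ _ h₁ h₂
    have hgk : ∀ x, g k (f j k hjk (f i j hij x)) = g i x := fun x => by rw [hg, hg]
    refine ⟨g k y, g k p, g k q, ?_, ?_, ?_⟩
    · rw [← hgk, ← map_add, ← map_nsmul, hy, ← map_nsmul, ← map_nsmul, hgk]
    · rw [← map_add, hp, hgk]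
    · rw [← hgk, ← map_add, hq]

theorem of_addEquiv {A B : Type*} [AddCommMonoid A] [AddCommMonoid B] (e : A ≃+ B)
    (h : IsLimitStableRefinementMonoid B) : IsLimitStableRefinementMonoid A :=
  of_directed (I := Unit) (G := fun _ => B) (fun _ _ _ => AddMonoidHom.id B)
    (fun _ => e.symm.toAddMonoidHom) (fun _ _ _ _ => rfl)
    (fun x => ⟨(), e x, e.symm_apply_apply x⟩) (fun _ _ _ h => ⟨(), le_rfl, e.symm.injective h⟩)
    fun _ => h

end IsLimitStableRefinementMonoid

theorem IsDirectLimitOfPointedCyclicSums.isPureRefinementMonoid {M : Type*} [AddCommMonoid M]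
    {u : M} (h : IsDirectLimitOfPointedCyclicSums M u) : IsPureRefinementMonoid M := by
  obtain ⟨I, _, _, _, G, _, v, f, _, hG, -, e, -⟩ := h
  refine (IsLimitStableRefinementMonoid.of_addEquiv e.symm ?_).isPureRefinementMonoid
  refine IsLimitStableRefinementMonoid.of_directed f
    (fun i => { toFun := fun x => ⟦⟨i, x⟩⟧
                map_zero' := (DirectLimit.zero_def i).symm
                map_add' := fun x y => (DirectLimit.add_def i x y).symm })
    (fun i j h x => DirectLimit.mk_apply i j x h) (fun x => ?_) (fun i x y hxy => ?_) fun i => ?_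
  · obtain ⟨i, y, rfl⟩ := DirectLimit.exists_eq_mk f x
    exact ⟨i, y, rfl⟩
  · obtain ⟨j, hij, _, h⟩ := Quotient.exact hxy
    exact ⟨j, hij, h⟩
  · obtain ⟨r, n, -, e, -⟩ := hG i
    exact .of_addEquiv e (.pi fun k => .withZero _)

theorem corollary6p8 (M : Type*) [AddCommMonoid M] (u : M) (hu : IsOrderUnit u) :
    IsDirectLimitOfPointedCyclicSums M u ↔
      IsRegularMonoid M ∧ IsConicalMonoid M ∧ IsRefinementMonoid M ∧
        EmbeddingCondition M ∧ PurityCondition M := by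
  constructor
  · intro h
    have := h.isPureRefinementMonoid
    exact ⟨this.regular, this.conical, this.refinement, this.emb, this.pur⟩
  · rintro ⟨h₁, h₂, h₃, h₄, h₅⟩
    have : IsPureRefinementMonoid M := ⟨h₁, h₂, h₃, h₄, h₅⟩
    exact IsPureRefinementMonoid.isDirectLimitOfPointedCyclicSums hu
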